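/- For a finite simple graph $G$ let $\mathcal{E}(G)$ denote its energy, i.e. the sum of the absolute values of the eigenvalues (counted with multiplicity) of its adjacency matrix. Let $k\ge 4$, $i\ge 2$ and $t_1,\dots,t_k\ge 1$ be integers, and let $G=K_{t_1,\dots,t_k}$ be the complete multipartite graph whose parts have sizes $t_1,\dots,t_k$. Suppose that $t_p=1$ and $t_q=i$ for some indices $p,q$ (so that, up to the order of the parts, $G$ is $K_{1,i,t_3,\dots,t_k}$). Then for every edge $e$ of $G$ joining the $p$-th part to the $q$-th part, $$\mathcal{E}(G-e)>\mathcal{E}(G),$$ where $G-e$ is obtained from $G$ by deleting the edge $e$ (keeping all vertices). -/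

import Mathlib

open Classical in
/-- The energy of a finite simple graph: the sum of the absolute values of the eigenvalues
(with multiplicity) of its real adjacency matrix. -/
noncomputable def SimpleGraph.adjEnergy {V : Type*} [Fintype V] (G : SimpleGraph V) : ℝ :=
  ∑ v : V, |(SimpleGraph.isHermitian_adjMatrix ℝ G).eigenvalues v|

/-- The complete multipartite graph with `k` parts, the `j`-th of which has `t j` vertices;
its vertices are the pairs of an index `j : Fin k` and an element of `Fin (t j)`. -/
abbrev SimpleGraph.completeMultipartite {k : ℕ} (t : Fin k → ℕ) :
    SimpleGraph (Σ j : Fin k, Fin (t j)) :=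
  SimpleGraph.completeMultipartiteGraph fun j => Fin (t j)

/-! An adjacency matrix is traceless, so the energy is twice the sum of the positive eigenvalues. A
complete multipartite graph has at most one of these, a root `r` of `∑ t j / (r + t j) = 1`.
Deleting `e` costs at most 7/20 in the largest eigenvalue but creates a second one exceeding 7/20,
so the total grows.

The second eigenvalue already lives on five vertices: the ends of `e`, another vertex of the `q`-th
part and one vertex from each of two further parts (`completeMultipartite_deleteEdges_plane`). The
largest one is bounded by a test vector (`completeMultipartite_deleteEdges_rayleigh`), whose
condition reduces to a polynomial inequality in `r` and `i` (`le_sum_div_add`,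
`radius_polynomial_nonneg`). -/

open Matrix

/-! ### Variational bounds for eigenvalues -/

namespace Matrix.IsHermitian

variable {n : Type*} [Fintype n] [DecidableEq n] {A : Matrix n n ℝ}

/-- The coordinate of `x` along the eigenvector of index `v`. -/
noncomputable def eigenCoord (hA : A.IsHermitian) (v : n) (x : n → ℝ) : ℝ :=
  ⇑(hA.eigenvectorBasis v) ⬝ᵥ x

theorem eigenCoord_add_smul (hA : A.IsHermitian) (v : n) (a b : ℝ) (x y : n → ℝ) :
    hA.eigenCoord v (a • x + b • y) = a * hA.eigenCoord v x + b * hA.eigenCoord v y := by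
  simp [eigenCoord, dotProduct_add, dotProduct_smul]

theorem inner_eigenvectorBasis (hA : A.IsHermitian) (v : n) (x : n → ℝ) :
    inner ℝ (hA.eigenvectorBasis v) (WithLp.toLp 2 x) = hA.eigenCoord v x := by
  simp [eigenCoord, EuclideanSpace.inner_eq_star_dotProduct, dotProduct_comm]

theorem sum_eigenCoord_mul (hA : A.IsHermitian) (x y : n → ℝ) :
    ∑ v, hA.eigenCoord v x * hA.eigenCoord v y = x ⬝ᵥ y := by
  have h := hA.eigenvectorBasis.sum_inner_mul_inner (WithLp.toLp 2 x) (WithLp.toLp 2 y)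
  simp only [inner_eigenvectorBasis] at h
  rw [EuclideanSpace.inner_eq_star_dotProduct] at h
  simp only [star_trivial] at h
  rw [dotProduct_comm x y, ← h]
  refine Finset.sum_congr rfl fun v _ => ?_
  rw [real_inner_comm, inner_eigenvectorBasis]

theorem eigenCoord_mulVec (hA : A.IsHermitian) (v : n) (x : n → ℝ) :
    hA.eigenCoord v (A *ᵥ x) = hA.eigenvalues v * hA.eigenCoord v x := by
  have hT : Aᵀ = A := by simpa using hA.eq
  rw [eigenCoord, dotProduct_mulVec, ← mulVec_transpose, hT, hA.mulVec_eigenvectorBasis,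
    smul_dotProduct, eigenCoord, smul_eq_mul]

theorem dotProduct_mulVec_eq_sum (hA : A.IsHermitian) (x : n → ℝ) :
    x ⬝ᵥ A *ᵥ x = ∑ v, hA.eigenvalues v * hA.eigenCoord v x ^ 2 := by
  rw [← hA.sum_eigenCoord_mul]
  refine Finset.sum_congr rfl fun v _ => ?_
  rw [eigenCoord_mulVec]; ring

theorem dotProduct_self_eq_sum (hA : A.IsHermitian) (x : n → ℝ) :
    x ⬝ᵥ x = ∑ v, hA.eigenCoord v x ^ 2 := by
  rw [← hA.sum_eigenCoord_mul]
  exact Finset.sum_congr rfl fun v _ => (sq _).symm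

/-- A Rayleigh quotient bounds some eigenvalue from below. -/
theorem exists_le_eigenvalues (hA : A.IsHermitian) {x : n → ℝ} (hx : 0 < x ⬝ᵥ x) {θ : ℝ}
    (h : θ * (x ⬝ᵥ x) ≤ x ⬝ᵥ A *ᵥ x) : ∃ v, θ ≤ hA.eigenvalues v := by
  by_contra! hlt
  have hx' := hx
  rw [hA.dotProduct_self_eq_sum] at hx'
  obtain ⟨v, -, hv⟩ := Finset.exists_lt_of_sum_lt (f := fun _ : n => (0 : ℝ)) (by simpa using hx')
  rw [hA.dotProduct_mulVec_eq_sum, hA.dotProduct_self_eq_sum, Finset.mul_sum] at h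
  refine absurd h (not_le.mpr (Finset.sum_lt_sum (fun w _ => ?_) ⟨v, Finset.mem_univ v, ?_⟩))
  · exact mul_le_mul_of_nonneg_right (hlt w).le (sq_nonneg _)
  · exact mul_lt_mul_of_pos_right (hlt v) hv

/-- If the quadratic form exceeds `δ` on a plane, then besides any given eigenvalue there is
another one exceeding `δ`. -/
theorem exists_ne_lt_eigenvalues (hA : A.IsHermitian) {x y : n → ℝ} {δ : ℝ}
    (h : ∀ a b : ℝ, (a ≠ 0 ∨ b ≠ 0) →
      δ * ((a • x + b • y) ⬝ᵥ (a • x + b • y)) < (a • x + b • y) ⬝ᵥ A *ᵥ (a • x + b • y))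
    (v : n) : ∃ w, w ≠ v ∧ δ < hA.eigenvalues w := by
  -- A plane meets the orthogonal complement of a single eigenvector nontrivially.
  obtain ⟨a, b, hab, h0⟩ : ∃ a b : ℝ, (a ≠ 0 ∨ b ≠ 0) ∧ hA.eigenCoord v (a • x + b • y) = 0 := by
    simp only [eigenCoord_add_smul]
    by_cases hx : hA.eigenCoord v x = 0
    · exact ⟨1, 0, by simp, by simp [hx]⟩
    · exact ⟨-hA.eigenCoord v y, hA.eigenCoord v x, Or.inr hx, by ring⟩
  have hlt := h a b hab
  by_contra! hle
  rw [hA.dotProduct_mulVec_eq_sum, hA.dotProduct_self_eq_sum, Finset.mul_sum] at hlt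
  refine absurd hlt (not_lt.mpr (Finset.sum_le_sum fun w _ => ?_))
  by_cases hw : w = v
  · simp [hw, h0]
  · exact mul_le_mul_of_nonneg_right (hle w hw) (sq_nonneg _)

/-- The sum of the absolute values of the eigenvalues of a traceless Hermitian matrix is twice the
sum of its positive eigenvalues. -/
theorem sum_abs_eigenvalues (hA : A.IsHermitian) (htr : A.trace = 0) :
    ∑ v, |hA.eigenvalues v| = 2 * ∑ v, max (hA.eigenvalues v) 0 := by
  have h : ∑ v, hA.eigenvalues v = 0 := by
    have := hA.trace_eq_sum_eigenvalues
    simpa [htr] using this.symm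
  rw [← add_eq_left (a := ∑ v, |hA.eigenvalues v|)] at h
  rw [← h, Finset.mul_sum, ← Finset.sum_add_distrib]
  refine Finset.sum_congr rfl fun v _ => ?_
  rcases le_total 0 (hA.eigenvalues v) with h | h
  · rw [abs_of_nonneg h, max_eq_left h]; ring
  · rw [abs_of_nonpos h, max_eq_right h]; ring

end Matrix.IsHermitian

/-! ### Energy through positive eigenvalues -/

namespace SimpleGraph

variable {V : Type*} [Fintype V]

open Classical in
theorem adjEnergy_eq (G : SimpleGraph V) :
    G.adjEnergy = 2 * ∑ v, max ((isHermitian_adjMatrix ℝ G).eigenvalues v) 0 :=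
  Matrix.IsHermitian.sum_abs_eigenvalues _ (trace_adjMatrix ℝ G)

/-- A lower bound for the energy from a Rayleigh quotient and a plane on which the quadratic form
is large. -/
theorem lt_adjEnergy (G : SimpleGraph V) [inst : DecidableRel G.Adj] {f x y : V → ℝ} {θ δ : ℝ}
    (hf : 0 < f ⬝ᵥ f) (hθ : θ * (f ⬝ᵥ f) ≤ f ⬝ᵥ G.adjMatrix ℝ *ᵥ f)
    (h : ∀ a b : ℝ, (a ≠ 0 ∨ b ≠ 0) →
      δ * ((a • x + b • y) ⬝ᵥ (a • x + b • y)) <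
        (a • x + b • y) ⬝ᵥ G.adjMatrix ℝ *ᵥ (a • x + b • y)) :
    2 * (θ + δ) < G.adjEnergy := by
  classical
  obtain rfl : inst = fun a b => Classical.propDecidable _ := Subsingleton.elim _ _
  rw [adjEnergy_eq]
  have hA := isHermitian_adjMatrix ℝ G
  obtain ⟨v, hv⟩ := hA.exists_le_eigenvalues hf hθ
  obtain ⟨w, hwv, hw⟩ := hA.exists_ne_lt_eigenvalues h v
  have hsub : ∑ z ∈ {v, w}, max (hA.eigenvalues z) 0 ≤ ∑ z, max (hA.eigenvalues z) 0 :=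
    Finset.sum_le_sum_of_subset_of_nonneg (Finset.subset_univ _) fun _ _ _ => le_max_right _ _
  rw [Finset.sum_pair hwv.symm] at hsub
  have h1 := le_max_left (hA.eigenvalues v) 0
  have h2 := le_max_left (hA.eigenvalues w) 0
  linarith

/-- If no two eigenvectors with positive eigenvalues are orthogonal, then there is at most one
positive eigenvalue, which determines the energy. -/
theorem adjEnergy_eq_zero_or (G : SimpleGraph V) [inst : DecidableRel G.Adj]
    (h : ∀ (x y : V → ℝ) (r s : ℝ), x ≠ 0 → y ≠ 0 → 0 < r → 0 < s →
      G.adjMatrix ℝ *ᵥ x = r • x → G.adjMatrix ℝ *ᵥ y = s • y → x ⬝ᵥ y ≠ 0) :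
    G.adjEnergy = 0 ∨ ∃ (r : ℝ) (x : V → ℝ), 0 < r ∧ x ≠ 0 ∧ G.adjMatrix ℝ *ᵥ x = r • x ∧
      G.adjEnergy = 2 * r := by
  classical
  obtain rfl : inst = fun a b => Classical.propDecidable _ := Subsingleton.elim _ _
  have hE := adjEnergy_eq G
  have hA := isHermitian_adjMatrix ℝ G
  have hne : ∀ w, ⇑(hA.eigenvectorBasis w) ≠ 0 := fun w h0 =>
    hA.eigenvectorBasis.orthonormal.ne_zero w (by ext a; exact congrFun h0 a)
  by_cases hpos : ∃ v, 0 < hA.eigenvalues v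
  · obtain ⟨v, hv⟩ := hpos
    refine Or.inr ⟨hA.eigenvalues v, _, hv, hne v, hA.mulVec_eigenvectorBasis v, ?_⟩
    rw [hE, Finset.sum_eq_single v (fun w _ hwv => max_eq_right ?_)
      (fun h => absurd (Finset.mem_univ v) h), max_eq_left hv.le]
    by_contra! hw
    refine h _ _ _ _ (hne v) (hne w) hv hw (hA.mulVec_eigenvectorBasis v)
      (hA.mulVec_eigenvectorBasis w) ?_
    have horth : inner ℝ (hA.eigenvectorBasis w) (hA.eigenvectorBasis v) = 0 :=
      hA.eigenvectorBasis.orthonormal.2 hwv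
    rwa [EuclideanSpace.inner_eq_star_dotProduct, star_trivial] at horth
  · push Not at hpos
    exact Or.inl (by rw [hE, Finset.sum_eq_zero fun v _ => max_eq_right (hpos v), mul_zero])

end SimpleGraph

/-! ### Real inequalities for the drop of the spectral radius -/

/-- The polynomial inequality behind the comparison of the spectral radii. -/
theorem radius_polynomial_nonneg {i r θ m D : ℝ} (hi : 2 ≤ i) (hr : 0 < r)
    (h : 0 ≤ r ^ 2 - 2 * r - 3 * i) (hθ : θ = r - 7 / 20) (hm : m = i - 1)
    (hD : D = θ ^ 3 + (m + 2) * θ ^ 2 + m * θ - m) :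
    0 ≤ D * (r * ((r ^ 2 - i) * (r + i) * (r + 1)) + 7 / 20 * ((r ^ 2 - i) * (r + i) * (r + 1)
      - (r ^ 2 - i) ^ 2 + 2 * (r + i) * (r ^ 2 - r - 2 * i)))
      - θ * (θ ^ 2 - m) * r * (r + i) ^ 2 * (r + 1) ^ 2 := by
  obtain ⟨x, hx⟩ : ∃ x, x = i - 2 := ⟨_, rfl⟩
  obtain ⟨w, hw⟩ : ∃ w, w = r - 1 := ⟨_, rfl⟩
  obtain ⟨z, hz⟩ : ∃ z, z = (r ^ 2 - 2 * r - 3 * i) / 3 := ⟨_, rfl⟩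
  have hx0 : 0 ≤ x := by linarith
  have hz0 : 0 ≤ z := by rw [hz]; positivity
  have hw0 : 0 ≤ w := by nlinarith
  -- Since `w ^ 2 = 3 * z + 3 * x + 7`, the expression reduces to degree one in `w`; all
  -- coefficients are then positive.
  have key : 0 ≤ (43622324 + 96608337 * z + 41262120 * z ^ 2 + 3456000 * z ^ 3 + 284595498 * x +
      277960539 * x * z + 66922560 * x * z ^ 2 + 3024000 * x * z ^ 3 + 265560666
      * x ^ 2 + 150283320 * x ^ 2 * z + 15566400 * x ^ 2 * z ^ 2 + 86086340 * x ^ 3 +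
      21591600 * x ^ 3 * z + 9049200 * x ^ 4 + w * (16511276 + 32976825 * z + 8967600 *
      z ^ 2 + 104153598 * x + 76455117 * x * z + 10494000 * x * z ^ 2 + 78709398
      * x ^ 2 + 28998360 * x ^ 2 * z + 1008000 * x ^ 2 * z ^ 2 + 18299900 * x ^ 3 + 2016000
      * x ^ 3 * z + 1008000 * x ^ 4)) / 160000 := by
    positivity
  refine key.trans_eq ?_
  rw [hz, hD, hm, hθ, hw, hx]
  ring

/-- If at least two numbers `y j ≥ l` are summed, then the sum of their squares is at most what it
is when one of two numbers equals `l`. -/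
theorem sum_sq_le_of_two_le_card {ι : Type*} {T : Finset ι} {y : ι → ℝ} {l : ℝ} (hl : 0 ≤ l)
    (hy : ∀ j ∈ T, l ≤ y j) (hT : 2 ≤ T.card) :
    2 * l ≤ ∑ j ∈ T, y j ∧ ∑ j ∈ T, y j ^ 2 ≤ l ^ 2 + (∑ j ∈ T, y j - l) ^ 2 := by
  classical
  obtain ⟨a, ha, b, hb, hab⟩ := Finset.one_lt_card.mp hT
  have hrest : l ≤ ∑ j ∈ T.erase a, y j := by
    refine (hy b hb).trans (Finset.single_le_sum (f := y) (fun j hj => ?_)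
      (Finset.mem_erase.mpr ⟨hab.symm, hb⟩))
    exact hl.trans (hy j (Finset.mem_of_mem_erase hj))
  have hsq : ∑ j ∈ T.erase a, y j ^ 2 ≤ (∑ j ∈ T.erase a, y j) ^ 2 :=
    Finset.sum_sq_le_sq_sum_of_nonneg fun j hj => hl.trans (hy j (Finset.mem_of_mem_erase hj))
  have hya := hy a ha
  rw [← Finset.add_sum_erase T y ha, ← Finset.add_sum_erase T (fun j => y j ^ 2) ha]
  refine ⟨by linarith, ?_⟩
  -- The difference of the two sides is twice this product.
  nlinarith [mul_nonneg (sub_nonneg.mpr hya) (sub_nonneg.mpr hrest)]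

/-- Data extracted from the characteristic equation of a complete multipartite graph with a part of
size `1`, a part of size `i` and at least two more parts. -/
theorem charEq_lower_bounds {ι : Type*} {T : Finset ι} {t : ι → ℝ} {i r : ℝ} (hi : 2 ≤ i)
    (hr : 0 < r) (ht : ∀ j ∈ T, 1 ≤ t j) (hT : 2 ≤ T.card)
    (h : 1 / (r + 1) + i / (r + i) + ∑ j ∈ T, t j / (r + t j) = 1) :
    0 ≤ r ^ 2 - 2 * r - 3 * i ∧
      (r ^ 2 - i) * (r + i) * (r + 1) - (r ^ 2 - i) ^ 2 + 2 * (r + i) * (r ^ 2 - r - 2 * i) ≤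
        (∑ j ∈ T, (t j / (r + t j) - (t j / (r + t j)) ^ 2)) * ((r + i) ^ 2 * (r + 1) ^ 2) ∧
      ∑ j ∈ T, t j / (r + t j) = (r ^ 2 - i) / ((r + i) * (r + 1)) := by
  have h1 : 0 < r + 1 := by linarith
  have h2 : 0 < r + i := by linarith
  have hl : ∀ j ∈ T, 1 / (r + 1) ≤ t j / (r + t j) := fun j hj => by
    have := ht j hj
    rw [div_le_div_iff₀ h1 (by linarith)]
    nlinarith
  obtain ⟨hY, hS⟩ := sum_sq_le_of_two_le_card (by positivity) hl hT
  have hYeq : ∑ j ∈ T, t j / (r + t j) = (r ^ 2 - i) / ((r + i) * (r + 1)) := by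
    rw [← sub_eq_iff_eq_add'.mpr h.symm]
    field_simp
    ring
  rw [Finset.sum_sub_distrib]
  generalize ∑ j ∈ T, (t j / (r + t j)) ^ 2 = S at hS ⊢
  rw [hYeq] at hY hS ⊢
  refine ⟨?_, ?_, rfl⟩
  · have := mul_le_mul_of_nonneg_right hY (mul_pos h2 h1).le
    rw [div_mul_cancel₀ _ (mul_pos h2 h1).ne'] at this
    have e : 2 * (1 / (r + 1)) * ((r + i) * (r + 1)) = 2 * (r + i) := by field_simp
    linarith
  · have := mul_le_mul_of_nonneg_right hS (by positivity : 0 ≤ (r + i) ^ 2 * (r + 1) ^ 2)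
    have e : ((1 / (r + 1)) ^ 2 + ((r ^ 2 - i) / ((r + i) * (r + 1)) - 1 / (r + 1)) ^ 2) *
        ((r + i) ^ 2 * (r + 1) ^ 2) = (r + i) ^ 2 + (r ^ 2 - i - (r + i)) ^ 2 := by field_simp
    have e' : (r ^ 2 - i) / ((r + i) * (r + 1)) * ((r + i) ^ 2 * (r + 1) ^ 2) =
        (r ^ 2 - i) * (r + i) * (r + 1) := by field_simp
    rw [sub_mul _ S, e']
    nlinarith

/-- Lowering the argument of the characteristic equation by `7 / 20` raises the contribution of the
remaining parts by enough to make up for a deleted edge. -/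
theorem le_sum_div_add {ι : Type*} {T : Finset ι} {t : ι → ℝ} {i r θ m D : ℝ} (hi : 2 ≤ i)
    (hr : 0 < r) (ht : ∀ j ∈ T, 1 ≤ t j) (hT : 2 ≤ T.card)
    (h : 1 / (r + 1) + i / (r + i) + ∑ j ∈ T, t j / (r + t j) = 1)
    (hθ : θ = r - 7 / 20) (hθ0 : 0 < θ) (hm : m = i - 1)
    (hD : D = θ ^ 3 + (m + 2) * θ ^ 2 + m * θ - m) (hD0 : 0 < D) :
    θ * (θ ^ 2 - m) / D ≤ ∑ j ∈ T, t j / (θ + t j) := by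
  obtain ⟨hri, hH, hY⟩ := charEq_lower_bounds hi hr ht hT h
  have hP := radius_polynomial_nonneg hi hr hri hθ hm hD
  -- By convexity, `s ↦ t j / (s + t j)` lies above its tangent at `r`. With `y = t j / (r + t j)`
  -- the slope there is `-(y - y ^ 2) / r`, hence the need for an upper bound on `∑ y ^ 2`.
  have hterm : ∀ j ∈ T, t j / (r + t j) + 7 / 20 / r * (t j / (r + t j) - (t j / (r + t j)) ^ 2) ≤
      t j / (θ + t j) := fun j hj => by
    have htj := ht j hj
    have ha : 0 < r + t j := by linarith
    have hb : 0 < θ + t j := by linarith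
    have e1 : 7 / 20 / r * (t j / (r + t j) - (t j / (r + t j)) ^ 2) =
        7 / 20 * t j / ((r + t j) * (r + t j)) := by field_simp; ring
    have e2 : t j / (θ + t j) - t j / (r + t j) = 7 / 20 * t j / ((θ + t j) * (r + t j)) := by
      rw [hθ] at hb ⊢
      rw [div_sub_div _ _ hb.ne' ha.ne']
      congr 1
      ring
    rw [e1, ← le_sub_iff_add_le', e2]
    refine div_le_div_of_nonneg_left (by linarith) (mul_pos hb ha) ?_
    exact mul_le_mul_of_nonneg_right (by linarith) ha.le
  refine le_trans ?_ (Finset.sum_le_sum hterm)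
  rw [Finset.sum_add_distrib, ← Finset.mul_sum, hY]
  generalize ∑ j ∈ T, (t j / (r + t j) - (t j / (r + t j)) ^ 2) = H at hH ⊢
  have h2 : 0 < r + i := by linarith
  rw [div_le_iff₀ hD0]
  have hc : 0 < r * ((r + i) ^ 2 * (r + 1) ^ 2) := by positivity
  refine le_of_mul_le_mul_right ?_ hc
  have e : ((r ^ 2 - i) / ((r + i) * (r + 1)) + 7 / 20 / r * H) * D *
      (r * ((r + i) ^ 2 * (r + 1) ^ 2)) =
      D * (r * ((r ^ 2 - i) * (r + i) * (r + 1)) +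
        7 / 20 * (H * ((r + i) ^ 2 * (r + 1) ^ 2))) := by
    field_simp
  rw [e]
  have := mul_le_mul_of_nonneg_left hH hD0.le
  linarith

/-! ### Spectrum of complete multipartite graphs -/

namespace SimpleGraph

variable {k : ℕ} {t : Fin k → ℕ}

open Classical in
theorem completeMultipartite_adjMatrix_mulVec (x : (Σ j : Fin k, Fin (t j)) → ℝ)
    (a : Σ j : Fin k, Fin (t j)) :
    ((completeMultipartite t).adjMatrix ℝ *ᵥ x) a = ∑ b, x b - ∑ s, x ⟨a.1, s⟩ := by
  have h : ∑ s, x ⟨a.1, s⟩ = ∑ b, if a.1 = b.1 then x b else 0 := by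
    rw [Fintype.sum_sigma, Finset.sum_eq_single a.1]
    · simp
    · intro j _ hj
      simp [hj.symm]
    · simp
  rw [h, ← Finset.sum_sub_distrib, mulVec, dotProduct]
  refine Finset.sum_congr rfl fun b _ => ?_
  by_cases hab : a.1 = b.1 <;> simp [adjMatrix_apply, hab]

open Classical in
/-- An eigenvector for a positive eigenvalue is constant on the parts, with explicit values. -/
theorem completeMultipartite_eigenvector_eq {x : (Σ j : Fin k, Fin (t j)) → ℝ} {r : ℝ} (hr : 0 < r)
    (hx : (completeMultipartite t).adjMatrix ℝ *ᵥ x = r • x) (a : Σ j : Fin k, Fin (t j)) :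
    x a = (∑ b, x b) / (r + t a.1) := by
  have h : ∀ s : Fin (t a.1), r * x ⟨a.1, s⟩ = ∑ b, x b - ∑ s, x ⟨a.1, s⟩ := fun s => by
    rw [← completeMultipartite_adjMatrix_mulVec x ⟨a.1, s⟩, hx]; rfl
  have hsum : r * ∑ s, x ⟨a.1, s⟩ = t a.1 * (∑ b, x b - ∑ s, x ⟨a.1, s⟩) := by
    rw [Finset.mul_sum, Finset.sum_congr rfl fun s _ => h s]
    simp only [Finset.sum_const, Finset.card_univ, Fintype.card_fin, nsmul_eq_mul]
  have ha := h a.2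
  have hpos : 0 < r + t a.1 := by positivity
  rw [eq_div_iff hpos.ne']
  refine mul_left_cancel₀ hr.ne' ?_
  linear_combination (r + t a.1) * ha - hsum

theorem sum_completeMultipartite_div (S r : ℝ) :
    ∑ b : Σ j : Fin k, Fin (t j), S / (r + t b.1) = S * ∑ j, (t j : ℝ) / (r + t j) := by
  rw [Fintype.sum_sigma, Finset.mul_sum]
  refine Finset.sum_congr rfl fun j _ => ?_
  simp only [Finset.sum_const, Finset.card_univ, Fintype.card_fin, nsmul_eq_mul]
  ring

/-- The energy of a complete multipartite graph is twice the root of its characteristic equation,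
unless it vanishes. -/
theorem completeMultipartite_adjEnergy (t : Fin k → ℕ) :
    (completeMultipartite t).adjEnergy = 0 ∨
      ∃ r : ℝ, 0 < r ∧ ∑ j, (t j : ℝ) / (r + t j) = 1 ∧
        (completeMultipartite t).adjEnergy = 2 * r := by
  classical
  have hS : ∀ {x : (Σ j : Fin k, Fin (t j)) → ℝ} {r : ℝ}, x ≠ 0 → 0 < r →
      (completeMultipartite t).adjMatrix ℝ *ᵥ x = r • x → ∑ b, x b ≠ 0 := fun hx hr h h0 =>
    hx (funext fun a => by rw [completeMultipartite_eigenvector_eq hr h a, h0, zero_div]; rfl)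
  refine (adjEnergy_eq_zero_or (completeMultipartite t)
    fun x y r s hx hy hr hs hAx hAy => ?_).imp_right ?_
  -- Every product `x a * y a` has the sign of the product of the two coordinate sums, so the inner
  -- product cannot vanish.
  · have hterm : ∀ a, x a * y a = (∑ b, x b) * (∑ b, y b) *
        (1 / ((r + t a.1) * (s + t a.1))) := fun a => by
      rw [completeMultipartite_eigenvector_eq hr hAx a,
        completeMultipartite_eigenvector_eq hs hAy a]
      field_simp
    obtain ⟨v, -⟩ := Function.ne_iff.mp hx
    rw [dotProduct, Finset.sum_congr rfl fun a _ => hterm a, ← Finset.mul_sum]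
    refine mul_ne_zero (mul_ne_zero (hS hx hr hAx) (hS hy hs hAy)) (ne_of_gt ?_)
    exact Finset.sum_pos (fun a _ => by positivity) ⟨v, Finset.mem_univ v⟩
  · rintro ⟨r, x, hr, hx, hAx, hE⟩
    refine ⟨r, hr, ?_, hE⟩
    have h := Finset.sum_congr rfl fun a (_ : a ∈ Finset.univ) =>
      completeMultipartite_eigenvector_eq hr hAx a
    rw [sum_completeMultipartite_div] at h
    exact (mul_left_cancel₀ (hS hx hr hAx) ((mul_one _).trans h)).symm

/-! ### The second eigenvalue after deleting an edge -/

theorem sum_ite_eq_dotProduct {ι V : Type*} [Fintype ι] [Fintype V] [DecidableEq V]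
    {φ : ι → V} (w : ι → ℝ) (g : V → ℝ) :
    (fun a => ∑ l, if φ l = a then w l else 0) ⬝ᵥ g = ∑ l, w l * g (φ l) := by
  simp only [dotProduct, Finset.sum_mul]
  rw [Finset.sum_comm]
  simp [ite_mul]

open Classical in
theorem completeMultipartite_deleteEdges_mulVec (x : (Σ j : Fin k, Fin (t j)) → ℝ)
    {u v : Σ j : Fin k, Fin (t j)} (huv : u.1 ≠ v.1) (a : Σ j : Fin k, Fin (t j)) :
    (((completeMultipartite t).deleteEdges {s(u, v)}).adjMatrix ℝ *ᵥ x) a =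
      ∑ b, x b - ∑ s, x ⟨a.1, s⟩ - (if a = u then x v else 0) - (if a = v then x u else 0) := by
  rw [← completeMultipartite_adjMatrix_mulVec]
  have h1 : (if a = u then x v else 0) = ∑ b, if a = u ∧ b = v then x b else 0 := by
    by_cases h : a = u <;> simp [h]
  have h2 : (if a = v then x u else 0) = ∑ b, if a = v ∧ b = u then x b else 0 := by
    by_cases h : a = v <;> simp [h]
  rw [h1, h2, mulVec, mulVec, dotProduct, dotProduct, ← Finset.sum_sub_distrib,
    ← Finset.sum_sub_distrib]
  refine Finset.sum_congr rfl fun b _ => ?_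
  have hne : u ≠ v := fun h => huv (congrArg _ h)
  have hne' : v ≠ u := hne.symm
  have huv' : v.1 ≠ u.1 := huv.symm
  by_cases hau : a = u
  · subst hau
    by_cases hbv : b = v
    · subst hbv; simp [adjMatrix_apply, hne, huv]
    · simp [adjMatrix_apply, hne, hbv]
  · by_cases hav : a = v
    · subst hav
      by_cases hbu : b = u
      · subst hbu; simp [adjMatrix_apply, hne', huv']
      · simp [adjMatrix_apply, hne', hbu]
    · simp [adjMatrix_apply, hau, hav]

open Classical in
/-- A plane on which the quadratic form of the graph without an edge exceeds `7 / 20`. -/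
theorem completeMultipartite_deleteEdges_plane {p q c d : Fin k} (hpq : p ≠ q) (hpc : p ≠ c)
    (hpd : p ≠ d) (hqc : q ≠ c) (hqd : q ≠ d) (hcd : c ≠ d) (u : Fin (t p)) {v b : Fin (t q)}
    (hvb : v ≠ b) (y : Fin (t c)) (z : Fin (t d)) :
    ∃ f g : (Σ j : Fin k, Fin (t j)) → ℝ, ∀ α β : ℝ, (α ≠ 0 ∨ β ≠ 0) →
      7 / 20 * ((α • f + β • g) ⬝ᵥ (α • f + β • g)) < (α • f + β • g) ⬝ᵥ
        ((completeMultipartite t).deleteEdges {s(⟨p, u⟩, ⟨q, v⟩)}).adjMatrix ℝ *ᵥ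
          (α • f + β • g) := by
  let φ : Fin 5 → Σ j : Fin k, Fin (t j) := ![⟨p, u⟩, ⟨q, v⟩, ⟨q, b⟩, ⟨c, y⟩, ⟨d, z⟩]
  have hlin : ∀ α β : ℝ, ∀ m n : Fin 5 → ℝ,
      (α • fun a => ∑ l, if φ l = a then m l else 0) +
        (β • fun a => ∑ l, if φ l = a then n l else 0) =
      fun a => ∑ l, if φ l = a then α * m l + β * n l else 0 := fun α β m n => by
    ext a
    simp only [Pi.add_apply, Pi.smul_apply, smul_eq_mul, Finset.mul_sum, ← Finset.sum_add_distrib]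
    refine Finset.sum_congr rfl fun l _ => ?_
    split_ifs <;> ring
  -- The second vector rounds an eigenvector of the induced five-vertex graph, whose second
  -- eigenvalue, about 0.358, is a root of `λ ^ 3 - 2 * λ ^ 2 - 5 * λ + 2`. The all-ones vector
  -- stands in for the Perron vector.
  refine ⟨fun a => ∑ l, if φ l = a then (![1, 1, 1, 1, 1] : Fin 5 → ℝ) l else 0,
    fun a => ∑ l, if φ l = a then (![-6, 11, -6, 2, 2] : Fin 5 → ℝ) l else 0, fun α β hαβ => ?_⟩
  have hmul : ∀ (M : Matrix (Σ j : Fin k, Fin (t j)) (Σ j : Fin k, Fin (t j)) ℝ)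
      (w : Fin 5 → ℝ) (a : Σ j : Fin k, Fin (t j)),
      (M *ᵥ fun a => ∑ l, if φ l = a then w l else 0) a = ∑ l, w l * M a (φ l) := fun M w a => by
    rw [mulVec, dotProduct_comm, sum_ite_eq_dotProduct]
  rw [hlin, sum_ite_eq_dotProduct, sum_ite_eq_dotProduct]
  simp only [hmul]
  simp only [Fin.sum_univ_five, φ, adjMatrix_apply, deleteEdges_adj]
  simp [hpq, hpc, hpd, hqc, hqd, hcd, hpq.symm, hpc.symm, hpd.symm, hqc.symm, hqd.symm, hcd.symm,
    hvb, hvb.symm]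
  have hpos : 0 < 285 / 20 * α ^ 2 + 2 * (19 / 20) * α * β + 33 / 20 * β ^ 2 := by
    rcases hαβ with h | h
    · nlinarith [sq_nonneg (α + β), sq_pos_of_ne_zero h, sq_nonneg β]
    · nlinarith [sq_nonneg (α + β), sq_pos_of_ne_zero h, sq_nonneg α]
  linarith

end SimpleGraph

/-! ### The largest eigenvalue after deleting an edge -/

namespace SimpleGraph

variable {k : ℕ} {t : Fin k → ℕ}

open Classical in
/-- A test vector on the graph without an edge whose Rayleigh quotient is at least `θ`. -/
theorem completeMultipartite_deleteEdges_rayleigh {p q : Fin k} (hpq : p ≠ q) (hp : t p = 1)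
    (u : Fin (t p)) (v : Fin (t q)) {θ m D : ℝ} (hθ : 0 < θ) (hm : m = t q - 1) (hm0 : 0 ≤ m)
    (hmθ : m ≤ θ ^ 2) (hD : D = θ ^ 3 + (m + 2) * θ ^ 2 + m * θ - m) (hD0 : 0 < D)
    (h : θ * (θ ^ 2 - m) / D ≤ ∑ j ∈ (Finset.univ.erase p).erase q, (t j : ℝ) / (θ + t j)) :
    ∃ f : (Σ j : Fin k, Fin (t j)) → ℝ, 0 < f ⬝ᵥ f ∧ θ * (f ⬝ᵥ f) ≤ f ⬝ᵥ
      ((completeMultipartite t).deleteEdges {s(⟨p, u⟩, ⟨q, v⟩)}).adjMatrix ℝ *ᵥ f := by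
  -- These solve the eigenvalue equations for `θ` on the parts `p` and `q`, with the total of the
  -- vector replaced by 1; `D` is the common denominator (see `e1`, `e2`, `e3`).
  let a := θ * (θ + m) / D
  let b := (θ ^ 2 - m) / D
  let c := θ * (θ + 1) / D
  have ha : 0 < a := by positivity
  have hb : 0 ≤ b := div_nonneg (by linarith) hD0.le
  have hc : 0 < c := by positivity
  have e1 : (θ + 1) * a + b = 1 := by
    simp only [a, b]; field_simp; rw [hD]; ring
  have e2 : a + (θ + 1) * b + m * c = 1 := by
    simp only [a, b, c]; field_simp; rw [hD]; ring
  have e3 : b + (θ + m) * c = 1 := by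
    simp only [b, c]; field_simp; rw [hD]; ring
  have e4 : θ * (θ ^ 2 - m) / D = 1 - (a + b + m * c) := by
    simp only [a, b, c]; field_simp; rw [hD]; ring
  clear_value a b c
  let f : (Σ j : Fin k, Fin (t j)) → ℝ := fun x =>
    if x.1 = p then a else if x = ⟨q, v⟩ then b else if x.1 = q then c else 1 / (θ + t x.1)
  have hf0 : ∀ x, 0 ≤ f x := fun x => by
    simp only [f]
    split_ifs
    exacts [ha.le, hb, hc.le, by positivity]
  have hfp : ∀ s, f ⟨p, s⟩ = a := fun s => by simp [f]
  have hfv : f ⟨q, v⟩ = b := by simp [f, hpq.symm]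
  have hfq : ∀ s, s ≠ v → f ⟨q, s⟩ = c := fun s hs => by simp [f, hpq.symm, hs]
  have hfj : ∀ j, j ≠ p → j ≠ q → ∀ s, f ⟨j, s⟩ = 1 / (θ + t j) := fun j hjp hjq s => by
    have : (⟨j, s⟩ : Σ j : Fin k, Fin (t j)) ≠ ⟨q, v⟩ := fun h => hjq (congrArg Sigma.fst h)
    simp [f, hjp, hjq, this]
  clear_value f
  have hsp : ∑ s, f ⟨p, s⟩ = a := by simp [hfp, hp]
  have hsq : ∑ s, f ⟨q, s⟩ = b + m * c := by
    rw [← Finset.add_sum_erase _ _ (Finset.mem_univ v), hfv,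
      Finset.sum_congr rfl fun s hs => hfq s (Finset.ne_of_mem_erase hs), Finset.sum_const,
      nsmul_eq_mul, Finset.card_erase_of_mem (Finset.mem_univ v), Finset.card_univ,
      Fintype.card_fin, Nat.cast_sub (Fin.pos v), hm, Nat.cast_one]
  have hsj : ∀ j, j ≠ p → j ≠ q → ∑ s, f ⟨j, s⟩ = t j / (θ + t j) := fun j hjp hjq => by
    simp [hfj j hjp hjq, div_eq_mul_inv]
  -- By `e4`, hypothesis `h` says exactly that the total is at least 1. The surplus is then added to
  -- every coordinate of `A f - θ f`, making it nonnegative.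
  have hsum : 1 ≤ ∑ x, f x := by
    rw [Fintype.sum_sigma, ← Finset.add_sum_erase _ _ (Finset.mem_univ p),
      ← Finset.add_sum_erase _ _ (Finset.mem_erase.mpr ⟨hpq.symm, Finset.mem_univ q⟩), hsp, hsq,
      Finset.sum_congr rfl fun j hj => hsj j
        (Finset.ne_of_mem_erase (Finset.mem_of_mem_erase hj)) (Finset.ne_of_mem_erase hj)]
    linarith
  have hle : ∀ x, θ * f x ≤
      (((completeMultipartite t).deleteEdges {s(⟨p, u⟩, ⟨q, v⟩)}).adjMatrix ℝ *ᵥ f) x := by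
    rintro ⟨j, s⟩
    rw [completeMultipartite_deleteEdges_mulVec f hpq, hfp, hfv]
    by_cases hjp : j = p
    · subst hjp
      have hsu : s = u := Fin.ext (by omega)
      have hne : (⟨j, u⟩ : Σ j : Fin k, Fin (t j)) ≠ ⟨q, v⟩ := fun h => hpq (congrArg Sigma.fst h)
      subst hsu
      rw [if_pos rfl, if_neg hne, hfp]
      simp only [hsp]
      linarith
    have hne : (⟨j, s⟩ : Σ j : Fin k, Fin (t j)) ≠ ⟨p, u⟩ := fun h => hjp (congrArg Sigma.fst h)
    rw [if_neg hne]
    by_cases hjq : j = q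
    · subst hjq
      simp only [hsq]
      by_cases hsv : s = v
      · subst hsv
        rw [if_pos rfl, hfv]
        linarith
      · rw [if_neg (by simpa using hsv), hfq s hsv]
        linarith
    · have hne' : (⟨j, s⟩ : Σ j : Fin k, Fin (t j)) ≠ ⟨q, v⟩ :=
        fun h => hjq (congrArg Sigma.fst h)
      rw [if_neg hne', hfj j hjp hjq]
      simp only [hsj j hjp hjq]
      have : θ * (1 / (θ + t j)) = 1 - t j / (θ + t j) := by field_simp; ring
      linarith
  refine ⟨f, ?_, ?_⟩
  · refine Finset.sum_pos' (fun x _ => mul_self_nonneg _) ⟨⟨p, u⟩, Finset.mem_univ _, ?_⟩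
    rw [hfp]
    exact mul_pos ha ha
  · rw [dotProduct, dotProduct, Finset.mul_sum]
    refine Finset.sum_le_sum fun x _ => ?_
    nlinarith [mul_le_mul_of_nonneg_left (hle x) (hf0 x)]

end SimpleGraph

/-! ### Comparison of the energies -/

theorem proposition3p4 (k i : ℕ) (hk : 4 ≤ k) (hi : 2 ≤ i)
    (t : Fin k → ℕ) (ht : ∀ j, 1 ≤ t j)
    (p q : Fin k) (hp : t p = 1) (hq : t q = i)
    (u : Fin (t p)) (v : Fin (t q)) :
    (SimpleGraph.completeMultipartite t).adjEnergy <
      ((SimpleGraph.completeMultipartite t).deleteEdges {s(⟨p, u⟩, ⟨q, v⟩)}).adjEnergy := by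
  classical
  have hpq : p ≠ q := by
    rintro rfl
    omega
  let T : Finset (Fin k) := (Finset.univ.erase p).erase q
  have hqmem : q ∈ Finset.univ.erase p := Finset.mem_erase.mpr ⟨hpq.symm, Finset.mem_univ q⟩
  have hT : 2 ≤ T.card := by
    rw [Finset.card_erase_of_mem hqmem, Finset.card_erase_of_mem (Finset.mem_univ p),
      Finset.card_univ, Fintype.card_fin]
    omega
  obtain ⟨c, hc, d, hd, hcd⟩ := Finset.one_lt_card.mp hT
  simp only [T, Finset.mem_erase, Finset.mem_univ, and_true] at hc hd
  have : Nontrivial (Fin (t q)) := Fin.nontrivial_iff_two_le.mpr (hq ▸ hi)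
  obtain ⟨b, hb⟩ := exists_ne v
  obtain ⟨x, y, hxy⟩ := SimpleGraph.completeMultipartite_deleteEdges_plane hpq hc.2.symm hd.2.symm
    hc.1.symm hd.1.symm hcd u hb.symm ⟨0, ht c⟩ ⟨0, ht d⟩
  rcases SimpleGraph.completeMultipartite_adjEnergy t with h0 | ⟨r, hr, hsum, hE⟩
  -- If the energy of `G` were 0, the trivial bound `θ = 0` from the all-ones vector would suffice.
  · have h := SimpleGraph.lt_adjEnergy (θ := 0) _ (f := fun _ => 1) ?_ ?_ hxy
    · rw [h0]
      linarith
    · exact Finset.sum_pos (fun _ _ => by simp) ⟨⟨p, u⟩, Finset.mem_univ _⟩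
    · rw [zero_mul]
      refine Finset.sum_nonneg fun a _ => mul_nonneg zero_le_one (Finset.sum_nonneg fun b _ => ?_)
      simp only [SimpleGraph.adjMatrix_apply, mul_one]
      split_ifs <;> simp
  · have hiR : (2 : ℝ) ≤ i := by exact_mod_cast hi
    have htT : ∀ j ∈ T, (1 : ℝ) ≤ t j := fun j _ => by exact_mod_cast ht j
    have hchar : 1 / (r + 1) + i / (r + i) + ∑ j ∈ T, (t j : ℝ) / (r + t j) = 1 := by
      rw [← Finset.add_sum_erase _ _ (Finset.mem_univ p), ← Finset.add_sum_erase _ _ hqmem, hp,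
        hq, Nat.cast_one] at hsum
      linarith
    obtain ⟨hri, -, -⟩ := charEq_lower_bounds hiR hr htT hT hchar
    obtain ⟨θ, hθ⟩ : ∃ θ, θ = r - 7 / 20 := ⟨_, rfl⟩
    obtain ⟨m, hm⟩ : ∃ m : ℝ, m = i - 1 := ⟨_, rfl⟩
    obtain ⟨D, hD⟩ : ∃ D, D = θ ^ 3 + (m + 2) * θ ^ 2 + m * θ - m := ⟨_, rfl⟩
    -- `hri` forces `r ≥ 1 + √7`, as `i ≥ 2`.
    have hθ1 : 1 < θ := by nlinarith
    have hm1 : 1 ≤ m := by linarith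
    have hmθ : m ≤ θ ^ 2 := by rw [hθ]; nlinarith
    have hD0 : 0 < D := by
      rw [hD]
      nlinarith [pow_pos (zero_lt_one.trans hθ1) 3, sq_nonneg θ]
    obtain ⟨f, hf, hfθ⟩ := SimpleGraph.completeMultipartite_deleteEdges_rayleigh hpq hp u v
      (zero_lt_one.trans hθ1) (by rw [hq, hm]) (by linarith) hmθ hD hD0
      (le_sum_div_add hiR hr htT hT hchar hθ (zero_lt_one.trans hθ1) hm hD hD0)
    have h := SimpleGraph.lt_adjEnergy _ hf hfθ hxy
    rw [hE]
    linarith
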